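/- Let $R$ be a unital ring (not necessarily commutative), let $X$ be a nonempty set, and for each $x\in X$ let $\sigma_x$ be a ring automorphism of $R$ and $\delta_x\colon R\to R$ a $\sigma_x$-derivation, i.e. an additive map with $\delta_x(ab)=\delta_x(a)b+\sigma_x(a)\delta_x(b)$ for all $a,b\in R$. Put $\mathscr{G}=\{\sigma_x\}_{x\in X}$ and $\mathscr{D}=\{\delta_x\}_{x\in X}$. Let $S=R[X;\mathscr{G},\mathscr{D}]$ be the free skew extension of $R$: a ring containing $R$ as a subring and (the images of) the variables $x\in X$, which is free as a left $R$-module with basis the free monoid $\langle X\rangle$ of words in $X$, and in which $xr=\sigma_x(r)x+\delta_x(r)$ for all $x\in X$, $r\in R$. (Such a ring exists and is unique up to isomorphism.) Let $\mathscr{P}(R)$ denote the prime radical of $R$ (the intersection of all prime two-sided ideals of $R$) and $\mathscr{J}(S)$ the Jacobson radical of $S$. A ring is called left Goldie if it contains no infinite direct sum of nonzero left ideals and satisfies the ascending chain condition on left annihilators of subsets. Suppose that 1. $\mathscr{P}(R)$ is nilpotent; 2. the factor ring $R/\mathscr{P}(R)$ is left Goldie; 3. $\delta_x(\mathscr{P}(R))\subseteq\mathscr{P}(R)$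 for all $x\in X$. Then $\mathscr{J}(R[X;\mathscr{G},\mathscr{D}])$ is nilpotent, and moreover $$\mathscr{J}(R[X;\mathscr{G},\mathscr{D}])=\mathscr{P}(R)[X;\mathscr{G},\mathscr{D}]:=\Big\{\sum_{\Delta\in\langle X\rangle} r_\Delta\Delta \;:\; r_\Delta\in\mathscr{P}(R),\ \text{almost all } r_\Delta=0\Big\}.$$ -/

import Mathlib

/-! ### Prime radical and left Goldie rings (not necessarily commutative) -/

/-- A proper two-sided ideal `P` of a ring is prime if `I * J ≤ P` implies `I ≤ P` or `J ≤ P`,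
for all two-sided ideals `I` and `J`. (Mathlib's `Ideal.IsPrime` is the elementwise condition,
which over a noncommutative ring is the stronger notion of a completely prime ideal.) -/
structure IsPrimeTwoSided {R : Type*} [Ring R] (P : Ideal R) : Prop where
  isTwoSided : P.IsTwoSided
  ne_top : P ≠ ⊤
  le_or_le : ∀ I J : Ideal R, I.IsTwoSided → J.IsTwoSided → I * J ≤ P → I ≤ P ∨ J ≤ P

/-- The prime radical of a ring: the intersection of all its prime two-sided ideals. -/
def primeRadical (R : Type*) [Ring R] : Ideal R :=
  sInf {P : Ideal R | IsPrimeTwoSided P}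

instance primeRadical_isTwoSided (R : Type*) [Ring R] : (primeRadical R).IsTwoSided where
  mul_mem_of_left {a} b ha := by
    refine Submodule.mem_sInf.2 fun P hP => ?_
    have hP' : IsPrimeTwoSided P := hP
    exact hP'.isTwoSided.mul_mem_of_left b (Submodule.mem_sInf.1 ha P hP)

/-- The left annihilator `{r | r A = 0}` of a subset `A` of a ring, as a left ideal. -/
def leftAnnihilator {R : Type*} [Ring R] (A : Set R) : Ideal R where
  carrier := {r | ∀ a ∈ A, r * a = 0}
  zero_mem' := fun a _ => zero_mul a
  add_mem' := fun {r s} hr hs a ha => by rw [add_mul, hr a ha, hs a ha, add_zero]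
  smul_mem' := fun c r hr a ha => by rw [smul_eq_mul, mul_assoc, hr a ha, mul_zero]

/-- A ring is left Goldie if it contains no infinite direct sum of nonzero left ideals and
satisfies the ascending chain condition on left annihilators. -/
structure IsLeftGoldie (R : Type*) [Ring R] : Prop where
  no_infinite_direct_sum : ¬ ∃ I : ℕ → Ideal R, iSupIndep I ∧ ∀ n, I n ≠ ⊥
  acc_leftAnnihilator : ∀ A : ℕ → Set R,
    (∀ n, leftAnnihilator (A n) ≤ leftAnnihilator (A (n + 1))) →
      ∃ n, ∀ m, n ≤ m → leftAnnihilator (A m) = leftAnnihilator (A n)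

/-! ### Free skew extensions -/

/-- The additive map `δ` is a skew derivation with respect to `σ` (a `σ`-derivation). -/
def IsSkewDerivation {R : Type*} [Ring R] (σ : R →+* R) (δ : R →+ R) : Prop :=
  ∀ a b : R, δ (a * b) = δ a * b + σ a * δ b

/-- The element `∑ r_Δ Δ` of `S` with coefficients `r_Δ` (given by `f`), where `ι : R → S` embeds
the coefficients, `v : X → S` embeds the variables, and `Δ` runs over the words in `X`. -/
noncomputable def skewSum {R S X : Type*} [Ring R] [Ring S] (ι : R →+* S) (v : X → S)
    (f : FreeMonoid X →₀ R) : S :=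
  f.sum fun Δ r => ι r * FreeMonoid.lift v Δ

/-- `S`, with coefficients embedded by `ι` and variables by `v`, is a free skew extension
`R[X; σ, δ]`: it contains `R` as a subring, it is free as a left `R`-module with basis the words
in the variables, and `x r = σ_x(r) x + δ_x(r)`. -/
structure IsFreeSkewExtension {R S X : Type*} [Ring R] [Ring S] (σ : X → R →+* R)
    (δ : X → R →+ R) (ι : R →+* S) (v : X → S) : Prop where
  injective : Function.Injective ι
  basis : Function.Bijective (skewSum ι v)
  relation : ∀ (x : X) (r : R), v x * ι r = ι (σ x r) * v x + ι (δ x r)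

/-- The subset `I[X; σ, δ]` of a free skew extension: all `∑ r_Δ Δ` with every `r_Δ` in `I`. -/
def coeffsIn {R S X : Type*} [Ring R] [Ring S] (ι : R →+* S) (v : X → S) (I : Ideal R) : Set S :=
  {s | ∃ f : FreeMonoid X →₀ R, (∀ Δ, f Δ ∈ I) ∧ skewSum ι v f = s}

/-! ### Free skew extensions exist -/

namespace FreeSkew

variable {R X : Type*} [Ring R] (σ : X → R →+* R) (δ : X → R →+ R)

/-- The additive operator `∑ r_Δ Δ ↦ ∑ (σ_x(r_Δ) x Δ + δ_x(r_Δ) Δ)`. -/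
noncomputable def hat (x : X) : AddMonoid.End (FreeMonoid X →₀ R) :=
  Finsupp.liftAddHom fun Δ =>
    (Finsupp.singleAddHom (FreeMonoid.of x * Δ)).comp (σ x).toAddMonoidHom +
      (Finsupp.singleAddHom Δ).comp (δ x)

theorem hat_single (x : X) (Δ : FreeMonoid X) (r : R) :
    hat σ δ x (Finsupp.single Δ r) =
      Finsupp.single (FreeMonoid.of x * Δ) (σ x r) + Finsupp.single Δ (δ x r) :=
  Finsupp.liftAddHom_apply_single
    (fun Δ => (Finsupp.singleAddHom (FreeMonoid.of x * Δ)).comp (σ x).toAddMonoidHom +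
      (Finsupp.singleAddHom Δ).comp (δ x)) Δ r

/-- The ring of operators generated by the left multiplications by elements of `R` and by the
operators `hat x`. -/
noncomputable def operatorRing : Subring (AddMonoid.End (FreeMonoid X →₀ R)) :=
  Subring.closure
    (Set.range (Module.toAddMonoidEnd R (FreeMonoid X →₀ R)) ∪ Set.range (hat σ δ))

/-- The embedding of the coefficients. -/
noncomputable def coeff : R →+* operatorRing σ δ :=
  (Module.toAddMonoidEnd R (FreeMonoid X →₀ R)).codRestrict (operatorRing σ δ) fun r =>
    Subring.subset_closure (Or.inl ⟨r, rfl⟩)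

/-- The embedding of the variables. -/
noncomputable def var (x : X) : operatorRing σ δ :=
  ⟨hat σ δ x, Subring.subset_closure (Or.inr ⟨x, rfl⟩)⟩


theorem skewSum_single {S : Type*} [Ring S] (ι : R →+* S) (v : X → S) (Δ : FreeMonoid X) (r : R) :
    skewSum ι v (Finsupp.single Δ r) = ι r * FreeMonoid.lift v Δ := by
  simp [skewSum]

theorem skewSum_add {S : Type*} [Ring S] (ι : R →+* S) (v : X → S) (f g : FreeMonoid X →₀ R) :
    skewSum ι v (f + g) = skewSum ι v f + skewSum ι v g :=
  Finsupp.sum_add_index' (by simp) (by simp [add_mul])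

theorem coeff_apply (r : R) (f : FreeMonoid X →₀ R) : (coeff σ δ r).1 f = r • f := rfl

theorem word_apply (hδ1 : ∀ x, δ x 1 = 0) (Δ : FreeMonoid X) :
    (FreeMonoid.lift (var σ δ) Δ).1 (Finsupp.single 1 1) = Finsupp.single Δ 1 := by
  induction Δ using FreeMonoid.inductionOn' with
  | one => simp
  | of_mul x Δ ih =>
    rw [map_mul, FreeMonoid.lift_eval_of]
    change hat σ δ x ((FreeMonoid.lift (var σ δ) Δ).1 (Finsupp.single 1 1)) = _
    rw [ih, hat_single, map_one, hδ1 x, Finsupp.single_zero, add_zero]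

theorem skewSum_apply (hδ1 : ∀ x, δ x 1 = 0) (f : FreeMonoid X →₀ R) :
    (skewSum (coeff σ δ) (var σ δ) f).1 (Finsupp.single 1 1) = f := by
  induction f using Finsupp.induction_linear with
  | zero => simp [skewSum]
  | add f g hf hg =>
    rw [skewSum_add]
    exact congrArg₂ (· + ·) hf hg
  | single Δ r =>
    rw [skewSum_single]
    change (coeff σ δ r).1 ((FreeMonoid.lift (var σ δ) Δ).1 (Finsupp.single 1 1)) = _
    rw [word_apply σ δ hδ1, coeff_apply, Finsupp.smul_single, smul_eq_mul, mul_one]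

theorem relation (hδ : ∀ x, IsSkewDerivation (σ x) (δ x)) (x : X) (r : R) :
    var σ δ x * coeff σ δ r =
      coeff σ δ (σ x r) * var σ δ x + coeff σ δ (δ x r) := by
  refine Subtype.ext (AddMonoidHom.ext fun f => ?_)
  change hat σ δ x (r • f) = σ x r • hat σ δ x f + δ x r • f
  induction f using Finsupp.induction_linear with
  | zero => simp
  | add f g hf hg => 
    rw [smul_add, map_add, hf, hg, map_add, smul_add, smul_add]; abel
  | single Δ a =>
    rw [Finsupp.smul_single, hat_single, hat_single, smul_eq_mul, hδ x r a, map_mul,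
      Finsupp.single_add, smul_add]
    simp only [Finsupp.smul_single, smul_eq_mul]
    abel

theorem map_one_eq_zero {σ : R →+* R} {δ : R →+ R} (h : IsSkewDerivation σ δ) : δ 1 = 0 := by
  simpa using h 1 1

theorem mul_skewSum (hδ : ∀ x, IsSkewDerivation (σ x) (δ x))
    (s : AddMonoid.End (FreeMonoid X →₀ R)) (hs : s ∈ operatorRing σ δ) :
    ∀ f : FreeMonoid X →₀ R, (⟨s, hs⟩ : operatorRing σ δ) * skewSum (coeff σ δ) (var σ δ) f =
      skewSum (coeff σ δ) (var σ δ) (s f) := by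
  let T : (FreeMonoid X →₀ R) →+ operatorRing σ δ :=
    AddMonoidHom.mk' (skewSum (coeff σ δ) (var σ δ)) (skewSum_add _ _)
  change ∀ f, (⟨s, hs⟩ : operatorRing σ δ) * T f = T (s f)
  have hT : ∀ Δ r, T (Finsupp.single Δ r) = coeff σ δ r * FreeMonoid.lift (var σ δ) Δ :=
    skewSum_single _ _
  induction hs using Subring.closure_induction with
  | mem s h =>
    intro f
    rcases h with ⟨r, rfl⟩ | ⟨x, rfl⟩
    · change coeff σ δ r * T f = T (r • f)
      induction f using Finsupp.induction_linear with
      | zero => simp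
      | add f g hf hg => rw [map_add, mul_add, hf, hg, smul_add, map_add]
      | single Δ a => rw [Finsupp.smul_single, hT, hT, ← mul_assoc, ← map_mul, smul_eq_mul]
    · change var σ δ x * T f = T (hat σ δ x f)
      induction f using Finsupp.induction_linear with
      | zero => simp
      | add f g hf hg => rw [map_add, mul_add, hf, hg, map_add, map_add]
      | single Δ a =>
        rw [hat_single, map_add, hT, hT, hT, ← mul_assoc, relation σ δ hδ, add_mul, map_mul,
          FreeMonoid.lift_eval_of, mul_assoc]
  | zero => intro f; exact (zero_mul _).trans (map_zero T).symm
  | one => intro f; exact one_mul _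
  | add s t hs ht ihs iht =>
    intro f
    exact (add_mul (⟨s, hs⟩ : operatorRing σ δ) ⟨t, ht⟩ (T f)).trans
      ((congrArg₂ (· + ·) (ihs f) (iht f)).trans (map_add T (s f) (t f)).symm)
  | neg s hs ih =>
    intro f
    exact (neg_mul (⟨s, hs⟩ : operatorRing σ δ) (T f)).trans
      ((congrArg Neg.neg (ih f)).trans (map_neg T (s f)).symm)
  | mul s t hs ht ihs iht =>
    intro f
    exact (mul_assoc (⟨s, hs⟩ : operatorRing σ δ) ⟨t, ht⟩ (T f)).trans
      ((congrArg (HMul.hMul (⟨s, hs⟩ : operatorRing σ δ)) (iht f)).trans (ihs (t f)))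

/-- Every family of ring endomorphisms and skew derivations has a free skew extension. -/
theorem isFreeSkewExtension (hδ : ∀ x, IsSkewDerivation (σ x) (δ x)) :
    IsFreeSkewExtension σ δ (coeff σ δ) (var σ δ) where
  injective := fun r s h => by
    have h1 := congrArg (fun t => t.1 (Finsupp.single (1 : FreeMonoid X) (1 : R))) h
    simp only [coeff_apply, Finsupp.smul_single, smul_eq_mul, mul_one] at h1
    exact Finsupp.single_injective _ h1
  relation := relation σ δ hδ
  basis := by
    refine ⟨fun f g h => ?_, ?_⟩
    · have h1 := fun x => map_one_eq_zero (hδ x)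
      rw [← skewSum_apply σ δ h1 f, h, skewSum_apply σ δ h1]
    · intro s
      refine ⟨s.1 (Finsupp.single 1 1), ?_⟩
      rw [← mul_skewSum σ δ hδ s.1 s.2, skewSum_single]
      simp

end FreeSkew

/-!
Write `P` for the prime radical of `R` and `P[X]` for the elements of `S` with coefficients in `P`.
Since `P` is stable under all `σ_x` and `δ_x`, reduction of coefficients is a surjective ring
homomorphism from `S` to a free skew extension of `R / P`, with kernel `P[X]`. The kernel is
nilpotent because `P` is (`IsFreeSkewExtension.coeffs_mem_pow`), so it lies in the Jacobson radical
of `S`. For equality it suffices that a free skew extension of the semiprime left Goldie ring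
`R / P` is semiprimitive (`IsFreeSkewExtension.jacobson_eq_bot`).

So let `R` be semiprime left Goldie, let `J` be the Jacobson radical of `S`, and grade words by
length. A word of length `m + n` factors in only one way into words of lengths `m` and `n`, so for
`f` of degree `m` and `g` of degree `n` the coefficient of `f g` at `Δ Γ` is `f_Δ σ_Δ(g_Γ)`
(`IsFreeSkewExtension.coeffs_mul`). For a word `Δ`, the coefficients at `Δ` of the elements of `J`
of degree at most `|Δ|` form a two-sided ideal `I_Δ`, and `I_Δ ⊆ I_{ΔΓ}`, `σ_Δ(I_Γ) ⊆ I_{ΔΓ}`. By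
the chain condition there is a nonempty word `Δ` whose double annihilator `I_Δ**` is maximal; then
`σ_Δ(I_Γ) ⊆ I_{ΔΓ} ⊆ I_Δ**` for every `Γ`. By the argument of Goldie's theorem
(`IsLeftGoldie.exists_mem_regular_on`) some `c` in `I_Δ` annihilates no nonzero element of `I_Δ**`
on its right. If `f` in `J` has degree at most `|Δ|` and coefficient `c` at `Δ`, then multiplication
by `1 - f` raises the degree of every nonzero element of `J` by at least `|Δ| > 0`. But `1 - f` is
a unit, so it permutes the nonzero elements of `J`; one of minimal degree gives a contradiction.
-/

/-! ### Semiprime left Goldie rings -/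

section Goldie

variable {R : Type*} [Ring R]

theorem mem_leftAnnihilator {A : Set R} {r : R} : r ∈ leftAnnihilator A ↔ ∀ a ∈ A, r * a = 0 :=
  Iff.rfl

theorem mem_leftAnnihilator_singleton {a r : R} : r ∈ leftAnnihilator {a} ↔ r * a = 0 := by
  simp [mem_leftAnnihilator]

theorem leftAnnihilator_anti {A B : Set R} (h : A ⊆ B) :
    leftAnnihilator B ≤ leftAnnihilator A :=
  fun _ hr a ha => hr a (h ha)

/-- The ascending chain condition on left annihilators, as a maximality principle. -/
theorem IsLeftGoldie.exists_maximal (hG : IsLeftGoldie R) {κ : Type*} [Nonempty κ]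
    (A : κ → Set R) :
    ∃ i, ∀ j, leftAnnihilator (A i) ≤ leftAnnihilator (A j) →
      leftAnnihilator (A j) ≤ leftAnnihilator (A i) := by
  have hwf : WellFoundedGT (Set.range (leftAnnihilator (R := R))) := by
    refine wellFoundedGT_iff_monotone_chain_condition.2 fun a => ?_
    choose B hB using fun n => (a n).2
    obtain ⟨n, hn⟩ := hG.acc_leftAnnihilator B fun n => by
      rw [hB, hB]
      exact a.mono n.le_succ
    refine ⟨n, fun m hm => Subtype.ext ?_⟩
    rw [← hB, ← hB, hn m hm]
  let F : κ → Set.range (leftAnnihilator (R := R)) := fun i => ⟨leftAnnihilator (A i), A i, rfl⟩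
  obtain ⟨_, ⟨i, rfl⟩, hi⟩ := hwf.wf.has_min _ (Set.range_nonempty F)
  refine ⟨i, fun j hij => ?_⟩
  by_contra hji
  exact hi (F j) ⟨j, rfl⟩ (lt_of_le_not_ge (α := Ideal R) hij hji)

/-- A sequence of left ideals is independent if each of them is disjoint from a left ideal
containing all the later ones. -/
theorem iSupIndep_of_disjoint_later (I K : ℕ → Ideal R) (hK : ∀ m n, n < m → I m ≤ K n)
    (hI : ∀ n, I n ⊓ K n = ⊥) : iSupIndep I := by
  classical
  rw [iSupIndep_iff_finsetSum_eq_zero_imp_eq_zero]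
  intro s v hv hsum i
  induction i using Nat.strong_induction_on with
  | _ i ih =>
    intro hi
    have h1 : v i ∈ K i := by
      rw [← s.add_sum_erase v hi] at hsum
      rw [eq_neg_of_add_eq_zero_left hsum]
      refine neg_mem (sum_mem fun j hj => ?_)
      obtain ⟨hji, hj⟩ := Finset.mem_erase.1 hj
      rcases lt_or_gt_of_ne hji with h | h
      · rw [ih j h hj]
        exact zero_mem _
      · exact hK j i h (hv j hj)
    have h2 : v i ∈ I i ⊓ K i := ⟨hv i hi, h1⟩
    rwa [hI, Submodule.mem_bot] at h2

/-- A form of semiprimeness: `a R a = 0` implies `a = 0`. -/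
def IsSemiprimeElementwise (R : Type*) [Ring R] : Prop :=
  ∀ a : R, (∀ r, a * r * a = 0) → a = 0

theorem IsSemiprimeElementwise.mul_eq_zero_of_swap (hR : IsSemiprimeElementwise R) {x y : R}
    (h : ∀ r, x * r * y = 0) : y * x = 0 := by
  refine hR _ fun r => ?_
  have : y * x * r * (y * x) = y * (x * r * y) * x := by noncomm_ring
  rw [this, h, mul_zero, zero_mul]

/-- The left annihilator of a left ideal is contained in its right annihilator. -/
theorem IsSemiprimeElementwise.mul_eq_zero_comm (hR : IsSemiprimeElementwise R) {I : Ideal R}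
    {x y : R} (h : ∀ a ∈ I, x * a = 0) (hy : y ∈ I) : y * x = 0 :=
  hR.mul_eq_zero_of_swap fun r => by rw [mul_assoc]; exact h _ (I.mul_mem_left r hy)

/-- A semiprime left Goldie ring has no nonzero nil left ideals. -/
theorem IsLeftGoldie.exists_mul_not_isNilpotent (hG : IsLeftGoldie R)
    (hR : IsSemiprimeElementwise R) {a : R} (ha : a ≠ 0) : ∃ r, ¬ IsNilpotent (r * a) := by
  by_contra! hnil
  -- A nonzero element `a * t` of `a R` whose left annihilator is as large as possible.
  have : Nonempty {t : R // a * t ≠ 0} := ⟨⟨1, by simpa using ha⟩⟩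
  obtain ⟨⟨t, ht⟩, hmax⟩ :=
    hG.exists_maximal (κ := {t : R // a * t ≠ 0}) (fun t => {a * t.1})
  refine ht (hR _ fun r => ?_)
  have hn : IsNilpotent (a * t * r) := by
    obtain ⟨n, hn⟩ := hnil (t * r)
    refine ⟨n + 1, ?_⟩
    have key : ∀ n, (a * t * r) ^ (n + 1) = a * (t * r * a) ^ n * (t * r) := by
      intro n
      induction n with
      | zero => simp [mul_assoc]
      | succ n ih => rw [pow_succ, ih, pow_succ]; simp only [mul_assoc]
    rw [key, hn, mul_zero, zero_mul]
  by_cases h0 : a * t * r = 0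
  · rw [h0, zero_mul]
  obtain ⟨k, hk0, hk1⟩ : ∃ k, (a * t * r) ^ (k + 1) ≠ 0 ∧ (a * t * r) ^ (k + 2) = 0 := by
    classical
    have hfind := Nat.find_spec hn
    have hpos : 2 ≤ Nat.find hn := by
      by_contra hlt
      exact h0 (by simpa using pow_eq_zero_of_le (show Nat.find hn ≤ 1 by omega) hfind)
    refine ⟨Nat.find hn - 2, Nat.find_min hn (by omega), ?_⟩
    rwa [Nat.sub_add_cancel hpos]
  have hw : (a * t * r) ^ (k + 1) = a * (t * r * (a * t * r) ^ k) := by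
    rw [pow_succ']; simp only [mul_assoc]
  have hle := hmax ⟨t * r * (a * t * r) ^ k, by rwa [← hw]⟩ fun y hy => by
    rw [mem_leftAnnihilator_singleton] at hy ⊢
    have : a * (t * r * (a * t * r) ^ k) = a * t * (r * (a * t * r) ^ k) := by
      simp only [mul_assoc]
    rw [this, ← mul_assoc, hy, zero_mul]
  have := @hle (a * t * r) (by
    rw [mem_leftAnnihilator_singleton, ← hw, ← pow_succ', hk1])
  rwa [mem_leftAnnihilator_singleton] at this

/-- A nonzero left ideal of a semiprime left Goldie ring contains a nonzero `b` such that `b` and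
`b ^ 2` have the same left annihilator. -/
theorem IsLeftGoldie.exists_mem_annihilator_sq (hG : IsLeftGoldie R)
    (hR : IsSemiprimeElementwise R) {L : Ideal R} {a : R} (haL : a ∈ L) (ha : a ≠ 0) :
    ∃ b ∈ L, b ≠ 0 ∧ ∀ y, y * b * b = 0 → y * b = 0 := by
  obtain ⟨r, hr⟩ := hG.exists_mul_not_isNilpotent hR ha
  -- The left annihilators of the powers of `r * a` become stationary.
  obtain ⟨n, hn⟩ := hG.exists_maximal (fun n : ℕ => {(r * a) ^ (n + 1)})
  refine ⟨(r * a) ^ (n + 1), ?_, fun h => hr ⟨_, h⟩, fun y hy => ?_⟩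
  · rw [pow_succ]
    exact L.mul_mem_left _ (L.mul_mem_left _ haL)
  · have := @hn (n + 1 + n) (fun y hy => by
      rw [mem_leftAnnihilator_singleton] at hy ⊢
      rw [show n + 1 + n + 1 = (n + 1) + (n + 1) by ring, pow_add, ← mul_assoc, hy, zero_mul]) y (by
      rw [mem_leftAnnihilator_singleton, show n + 1 + n + 1 = (n + 1) + (n + 1) by ring, pow_add,
        ← mul_assoc, hy])
    rwa [mem_leftAnnihilator_singleton] at this

/-- A left ideal of a semiprime left Goldie ring contains an element that is not annihilated on
the left by a nonzero element of the ideal. -/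
theorem IsLeftGoldie.exists_mem_leftAnnihilator_inf (hG : IsLeftGoldie R)
    (hR : IsSemiprimeElementwise R) (I : Ideal R) :
    ∃ c ∈ I, ∀ y ∈ I, y * c = 0 → y = 0 := by
  by_contra! hI
  let C := {c : R // c ∈ I ∧ ∀ y, y * c * c = 0 → y * c = 0}
  have hex : ∀ c : C, ∃ b ∈ I, b * c.1 = 0 ∧ b ≠ 0 ∧ ∀ y, y * b * b = 0 → y * b = 0 := by
    rintro ⟨c, hcI, hc⟩
    obtain ⟨y, hyI, hyc, hy⟩ := hI c hcI
    obtain ⟨b, hb, h0, hb2⟩ := hG.exists_mem_annihilator_sq hR (L := I ⊓ leftAnnihilator {c})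
      ⟨hyI, mem_leftAnnihilator_singleton.2 hyc⟩ hy
    exact ⟨b, hb.1, mem_leftAnnihilator_singleton.1 hb.2, h0, hb2⟩
  choose b hbI hbc hb0 hb2 using hex
  -- If `b c = 0`, the left annihilator of `c + b` is the intersection of those of `c` and `b`.
  have hadd : ∀ (c : C) (y : R), y * (c.1 + b c) = 0 → y * c.1 = 0 ∧ y * b c = 0 := by
    intro c y hy
    have h1 : y * c.1 = 0 := by
      refine c.2.2 y ?_
      have : y * (c.1 + b c) * c.1 = y * c.1 * c.1 + y * (b c * c.1) := by noncomm_ring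
      rw [hy, hbc, mul_zero, add_zero, zero_mul] at this
      exact this.symm
    refine ⟨h1, ?_⟩
    rwa [mul_add, h1, zero_add] at hy
  -- Starting from `c 0 = 0`, let `c (n + 1)` be the sum of `c n` and the corresponding `b`; the left
  -- ideals generated by these elements `b` then form an infinite direct sum.
  let next : C → C := fun c => ⟨c.1 + b c, add_mem c.2.1 (hbI c), fun y hy => by
    obtain ⟨h1, h2⟩ := hadd c _ hy
    have h3 : y * c.1 = 0 := by
      refine c.2.2 y ?_
      have : y * (c.1 + b c) * c.1 = y * c.1 * c.1 + y * (b c * c.1) := by noncomm_ring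
      rw [h1, hbc, mul_zero, add_zero] at this
      exact this.symm
    have h4 : y * b c = 0 := by
      refine hb2 c y ?_
      rwa [mul_add, h3, zero_add] at h2
    rw [mul_add, h3, h4, add_zero]⟩
  let c : ℕ → C := fun n => Nat.rec ⟨0, zero_mem _, by simp⟩ (fun _ => next) n
  have hc : ∀ m n, n < m → ∀ y, y * (c m).1 = 0 → y * b (c n) = 0 := by
    intro m
    induction m with
    | zero => intro n hn; omega
    | succ m ih =>
      intro n hn y hy
      obtain ⟨h1, h2⟩ := hadd (c m) y hy
      rcases (Nat.lt_succ_iff.1 hn).lt_or_eq with h | rfl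
      · exact ih n h y h1
      · exact h2
  refine hG.no_infinite_direct_sum ⟨fun n => Ideal.span {b (c n)},
    iSupIndep_of_disjoint_later _ (fun n => leftAnnihilator {b (c n)}) ?_ ?_, fun n h => ?_⟩
  · intro m n hnm
    rw [Ideal.span_singleton_le_iff_mem, mem_leftAnnihilator_singleton]
    exact hc m n hnm _ (hbc _)
  · intro n
    refine eq_bot_iff.2 fun y hy => ?_
    obtain ⟨z, rfl⟩ := Ideal.mem_span_singleton'.1 hy.1
    exact hb2 _ _ (mem_leftAnnihilator_singleton.1 hy.2)
  · exact hb0 _ (Ideal.span_singleton_eq_bot.1 h)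

/-- The left singular ideal of a semiprime left Goldie ring is zero: an element whose left
annihilator is an essential left ideal vanishes. -/
theorem IsLeftGoldie.eq_zero_of_essential (hG : IsLeftGoldie R) (hR : IsSemiprimeElementwise R)
    {b : R} (hb : ∀ a ≠ 0, ∃ r, r * a ≠ 0 ∧ r * a * b = 0) : b = 0 := by
  by_contra h0
  let Z := {b : R // b ≠ 0 ∧ ∀ a ≠ 0, ∃ r, r * a ≠ 0 ∧ r * a * b = 0}
  have : Nonempty Z := ⟨⟨b, h0, hb⟩⟩
  -- Among the nonzero elements of the singular ideal, `z` has maximal left annihilator.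
  obtain ⟨⟨z, hz0, hz⟩, hmax⟩ := hG.exists_maximal (fun z : Z => {z.1})
  refine hz0 (hR z fun r => ?_)
  by_contra hzr
  have hle := hmax ⟨z * r * z, hzr, fun a ha => by
    obtain ⟨s, hs, hs0⟩ := hz a ha
    exact ⟨s, hs, by rw [← mul_assoc, ← mul_assoc, hs0, zero_mul, zero_mul]⟩⟩ fun y hy => by
      rw [mem_leftAnnihilator_singleton] at hy ⊢
      change y * z = 0 at hy
      change y * (z * r * z) = 0
      rw [mul_assoc z, ← mul_assoc, hy, zero_mul]
  -- The annihilator of `z` is essential, hence meets `R z r`.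
  obtain ⟨s, hs, hs0⟩ : ∃ s, s * z ≠ 0 ∧ s * z * (r * z) = 0 := by
    obtain ⟨s, hs, hs0⟩ := hz (z * r) fun h => hzr (by rw [h, zero_mul])
    exact ⟨s, fun h => hs (by rw [← mul_assoc, h, zero_mul]), by
      rw [← hs0]; simp only [mul_assoc]⟩
  have := @hle s (by
    rw [mem_leftAnnihilator_singleton]
    change s * (z * r * z) = 0
    rw [← hs0]
    simp only [mul_assoc])
  exact hs (mem_leftAnnihilator_singleton.1 this)

/-- A two-sided ideal `I` of a semiprime left Goldie ring contains an element `c` that is left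
regular on the double annihilator of `I`. -/
theorem IsLeftGoldie.exists_mem_regular_on (hG : IsLeftGoldie R) (hR : IsSemiprimeElementwise R)
    (I : Ideal R) (hI : I.IsTwoSided) :
    ∃ c ∈ I, ∀ b ∈ leftAnnihilator (leftAnnihilator (I : Set R) : Set R), c * b = 0 → b = 0 := by
  obtain ⟨c, hcI, hc⟩ := hG.exists_mem_leftAnnihilator_inf hR I
  refine ⟨c, hcI, fun b hb hcb => hG.eq_zero_of_essential hR fun a ha => ?_⟩
  -- The annihilator of `b` contains `R c` and the annihilator of `I`; their sum is essential.
  by_cases haI : ∀ x ∈ I, x * a = 0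
  · refine ⟨1, by rwa [one_mul], ?_⟩
    rw [one_mul]
    refine hR.mul_eq_zero_comm hb ?_
    intro x hx
    exact hR.mul_eq_zero_of_swap fun r => haI _ (hI.mul_mem_of_left r hx)
  push Not at haI
  obtain ⟨x, hxI, hxa⟩ := haI
  -- Otherwise `R c` meets `R x a` trivially, and `∑ R x a c ^ n` is an infinite direct sum.
  by_contra! hcon
  have hinf : ∀ y z : R, y * (x * a) = z * c → y * (x * a) = 0 := by
    intro y z hyz
    by_contra hne
    refine hcon (y * x) (by rwa [mul_assoc]) ?_
    rw [mul_assoc y, hyz, mul_assoc, hcb, mul_zero]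
  have hxaI : x * a ∈ I := hI.mul_mem_of_left a hxI
  have hpow : ∀ n, ∀ y ∈ I, y * c ^ n = 0 → y = 0 := by
    intro n
    induction n with
    | zero => intro y _ h; simpa using h
    | succ n ih =>
      intro y hy h
      rw [pow_succ', ← mul_assoc] at h
      exact hc y hy (ih _ (I.mul_mem_left y hcI) h)
  refine hG.no_infinite_direct_sum ⟨fun n => Ideal.span {x * a * c ^ n},
    iSupIndep_of_disjoint_later _ (fun n => Ideal.span {c ^ (n + 1)}) ?_ ?_, fun n h => ?_⟩
  · intro m n hnm
    rw [Ideal.span_singleton_le_iff_mem, Ideal.mem_span_singleton']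
    obtain ⟨k, rfl⟩ := Nat.exists_eq_add_of_le (Nat.succ_le_of_lt hnm)
    exact ⟨x * a * c ^ k, by rw [Nat.succ_eq_add_one, add_comm (n + 1), pow_add c k, mul_assoc]⟩
  · intro n
    refine eq_bot_iff.2 fun y hy => ?_
    obtain ⟨z, rfl⟩ := Ideal.mem_span_singleton'.1 hy.1
    obtain ⟨w, hw⟩ := Ideal.mem_span_singleton'.1 hy.2
    have h1 : z * (x * a) - w * c = 0 := by
      refine hpow n _ (sub_mem (I.mul_mem_left _ hxaI) (I.mul_mem_left _ hcI)) ?_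
      rw [sub_mul, mul_assoc w, ← pow_succ', hw, mul_assoc z, sub_self]
    rw [Submodule.mem_bot, ← mul_assoc, hinf z w (sub_eq_zero.1 h1), zero_mul]
  · exact hxa (hpow n _ hxaI (Ideal.span_singleton_eq_bot.1 h))

end Goldie

/-! ### Coefficients in a free skew extension -/

section Coeffs

variable {R S X : Type*} [Ring R] [Ring S] {σ : X → R →+* R} {δ : X → R →+ R} {ι : R →+* S}
  {v : X → S}

/-- The coefficients of an element of a free skew extension with respect to the words. -/
noncomputable def IsFreeSkewExtension.coeffs (hS : IsFreeSkewExtension σ δ ι v) :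
    S ≃+ (FreeMonoid X →₀ R) :=
  (AddEquiv.ofBijective (AddMonoidHom.mk' (skewSum ι v) (FreeSkew.skewSum_add ι v)) hS.basis).symm

variable (hS : IsFreeSkewExtension σ δ ι v)

namespace IsFreeSkewExtension

theorem coeffs_skewSum (f : FreeMonoid X →₀ R) : hS.coeffs (skewSum ι v f) = f :=
  hS.coeffs.apply_symm_apply f

theorem skewSum_coeffs (s : S) : skewSum ι v (hS.coeffs s) = s :=
  hS.coeffs.symm_apply_apply s

theorem coeffs_monomial (r : R) (Δ : FreeMonoid X) :
    hS.coeffs (ι r * FreeMonoid.lift v Δ) = Finsupp.single Δ r := by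
  rw [← FreeSkew.skewSum_single, coeffs_skewSum]

theorem induction (hS : IsFreeSkewExtension σ δ ι v) {p : S → Prop} (zero : p 0)
    (add : ∀ s t, p s → p t → p (s + t))
    (monomial : ∀ r Δ, p (ι r * FreeMonoid.lift v Δ)) (s : S) : p s := by
  rw [← hS.skewSum_coeffs s]
  induction hS.coeffs s using Finsupp.induction_linear with
  | zero => simpa [skewSum] using zero
  | add f g hf hg => rw [FreeSkew.skewSum_add]; exact add _ _ hf hg
  | single Δ r => rw [FreeSkew.skewSum_single]; exact monomial r Δ

theorem coeffs_coeff_mul (r : R) (s : S) : hS.coeffs (ι r * s) = r • hS.coeffs s := by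
  induction s using hS.induction with
  | zero => simp
  | add s t hs ht => rw [mul_add, map_add, hs, ht, map_add, smul_add]
  | monomial a Δ =>
    rw [← mul_assoc, ← map_mul, coeffs_monomial, coeffs_monomial, Finsupp.smul_single, smul_eq_mul]

theorem coeffs_var_mul (x : X) (s : S) :
    hS.coeffs (v x * s) = FreeSkew.hat σ δ x (hS.coeffs s) := by
  induction s using hS.induction with
  | zero => simp
  | add s t hs ht => rw [mul_add, map_add, hs, ht, map_add, map_add]
  | monomial a Δ =>
    rw [← mul_assoc, hS.relation, add_mul, mul_assoc, ← FreeMonoid.lift_eval_of v x, ← map_mul,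
      map_add, coeffs_monomial, coeffs_monomial, coeffs_monomial, FreeSkew.hat_single]

theorem hat_apply_of_mul [DecidableEq X] (x y : X) (f : FreeMonoid X →₀ R) (Δ : FreeMonoid X) :
    FreeSkew.hat σ δ x f (FreeMonoid.of y * Δ) =
      (if y = x then σ x (f Δ) else 0) + δ x (f (FreeMonoid.of y * Δ)) := by
  classical
  induction f using Finsupp.induction_linear with
  | zero => simp
  | add f g hf hg =>
    rw [map_add, Finsupp.add_apply, hf, hg, Finsupp.add_apply, Finsupp.add_apply, map_add, map_add]
    split_ifs <;> abel
  | single Γ r =>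
    have hcons : FreeMonoid.of x * Γ = FreeMonoid.of y * Δ ↔ y = x ∧ Γ = Δ := by
      rw [eq_comm (a := y)]
      exact List.cons_eq_cons
    rw [FreeSkew.hat_single, Finsupp.add_apply, Finsupp.single_apply, Finsupp.single_apply,
      Finsupp.single_apply, Finsupp.single_apply]
    simp only [hcons, apply_ite (σ x), apply_ite (δ x), map_zero, ite_and]

theorem mem_coeffsIn {I : Ideal R} {s : S} :
    s ∈ coeffsIn ι v I ↔ ∀ Δ, hS.coeffs s Δ ∈ I := by
  constructor
  · rintro ⟨f, hf, rfl⟩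
    rwa [coeffs_skewSum]
  · exact fun h => ⟨_, h, hS.skewSum_coeffs s⟩

/-- The universal property: a ring homomorphism on the coefficients and images of the variables
satisfying the commutation relation extend to the free skew extension. -/
noncomputable def lift {T : Type*} [Ring T] (φ : R →+* T) (w : X → T)
    (hw : ∀ x r, w x * φ r = φ (σ x r) * w x + φ (δ x r)) : S →+* T where
  toFun s := skewSum φ w (hS.coeffs s)
  map_zero' := by simp [skewSum]
  map_add' s t := by rw [map_add, FreeSkew.skewSum_add]
  map_one' := by
    have := hS.coeffs_monomial 1 1
    rw [map_one, map_one, one_mul] at this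
    rw [this, FreeSkew.skewSum_single, map_one, map_one, one_mul]
  map_mul' := by
    have hmon : ∀ r Δ, skewSum φ w (hS.coeffs (ι r * FreeMonoid.lift v Δ)) =
        φ r * FreeMonoid.lift w Δ := fun r Δ => by
      rw [coeffs_monomial, FreeSkew.skewSum_single]
    have hadd : ∀ s t, skewSum φ w (hS.coeffs (s + t)) =
        skewSum φ w (hS.coeffs s) + skewSum φ w (hS.coeffs t) := fun s t => by
      rw [map_add, FreeSkew.skewSum_add]
    have h0 : skewSum φ w (hS.coeffs 0) = 0 := by simp [skewSum]
    have hcoeff : ∀ r s, skewSum φ w (hS.coeffs (ι r * s)) = φ r * skewSum φ w (hS.coeffs s) := by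
      intro r s
      induction s using hS.induction with
      | zero => rw [mul_zero, h0, mul_zero]
      | add s t hs ht => rw [mul_add, hadd, hs, ht, hadd, mul_add]
      | monomial a Δ => rw [← mul_assoc, ← map_mul, hmon, hmon, map_mul, mul_assoc]
    have hvar : ∀ x s, skewSum φ w (hS.coeffs (v x * s)) = w x * skewSum φ w (hS.coeffs s) := by
      intro x s
      induction s using hS.induction with
      | zero => rw [mul_zero, h0, mul_zero]
      | add s t hs ht => rw [mul_add, hadd, hs, ht, hadd, mul_add]
      | monomial a Δ =>
        rw [← mul_assoc, hS.relation, add_mul, mul_assoc, ← FreeMonoid.lift_eval_of v x, ← map_mul,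
          hadd, hmon, hmon, hmon, ← mul_assoc, hw, add_mul, map_mul, FreeMonoid.lift_eval_of,
          mul_assoc]
    have hword : ∀ Δ s, skewSum φ w (hS.coeffs (FreeMonoid.lift v Δ * s)) =
        FreeMonoid.lift w Δ * skewSum φ w (hS.coeffs s) := by
      intro Δ s
      induction Δ using FreeMonoid.inductionOn' with
      | one => simp
      | of_mul x Δ ih =>
        rw [(FreeMonoid.lift v).map_mul, (FreeMonoid.lift w).map_mul, mul_assoc,
          FreeMonoid.lift_eval_of, FreeMonoid.lift_eval_of, hvar, ih, mul_assoc]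
    intro s t
    induction s using hS.induction with
    | zero => rw [zero_mul, h0, zero_mul]
    | add s s' hs hs' => rw [add_mul, hadd, hs, hs', hadd, add_mul]
    | monomial a Δ => rw [mul_assoc, hcoeff, hword, hmon, mul_assoc]

/-- The elements of degree at most `n`, the degree of a word being its length. -/
noncomputable def degLE (n : ℕ) : AddSubgroup S where
  carrier := {s | ∀ Δ, n < Δ.length → hS.coeffs s Δ = 0}
  zero_mem' := by simp
  add_mem' hs ht Δ hΔ := by rw [map_add, Finsupp.add_apply, hs Δ hΔ, ht Δ hΔ, add_zero]
  neg_mem' hs Δ hΔ := by rw [map_neg, Finsupp.neg_apply, hs Δ hΔ, neg_zero]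

theorem monomial_mem_degLE (r : R) (Δ : FreeMonoid X) :
    ι r * FreeMonoid.lift v Δ ∈ hS.degLE Δ.length := by
  classical
  intro Γ hΓ
  rw [coeffs_monomial, Finsupp.single_apply, if_neg]
  rintro rfl
  exact lt_irrefl _ hΓ

theorem exists_degLE (s : S) : ∃ n, s ∈ hS.degLE n := by
  refine ⟨(hS.coeffs s).support.sup FreeMonoid.length, fun Δ hΔ => ?_⟩
  by_contra h
  exact absurd (Finset.le_sup (f := FreeMonoid.length) (Finsupp.mem_support_iff.2 h))
    (not_le.2 hΔ)

end IsFreeSkewExtension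

end Coeffs

/-! ### Leading coefficients -/

section Leading

variable {R S X : Type*} [Ring R] [Ring S] {σ : X → R ≃+* R} {δ : X → R →+ R} {ι : R →+* S}
  {v : X → S} (hS : IsFreeSkewExtension (fun x => (σ x : R →+* R)) δ ι v)

/-- The automorphism `σ_x ∘ σ_y ∘ ⋯` attached to a word `x y ⋯`. -/
def wordAut (σ : X → R ≃+* R) : FreeMonoid X →* RingAut R :=
  FreeMonoid.lift σ

theorem wordAut_of_mul_apply (x : X) (Δ : FreeMonoid X) (r : R) :
    wordAut σ (FreeMonoid.of x * Δ) r = σ x (wordAut σ Δ r) := by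
  rw [map_mul, wordAut, FreeMonoid.lift_eval_of]
  rfl

namespace IsFreeSkewExtension

theorem coeffs_var_mul_of_mem_degLE [DecidableEq X] {n : ℕ} {g : S} (hg : g ∈ hS.degLE n)
    (x y : X) {Γ : FreeMonoid X} (hΓ : n ≤ Γ.length) :
    hS.coeffs (v x * g) (FreeMonoid.of y * Γ) = if y = x then σ x (hS.coeffs g Γ) else 0 := by
  rw [coeffs_var_mul, hat_apply_of_mul, hg (FreeMonoid.of y * Γ), map_zero, add_zero]
  · rfl
  · rw [FreeMonoid.length_mul, FreeMonoid.length_of]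
    omega

theorem var_mul_mem_degLE {n : ℕ} {g : S} (hg : g ∈ hS.degLE n) (x : X) :
    v x * g ∈ hS.degLE (n + 1) := by
  classical
  intro Δ hΔ
  induction Δ using FreeMonoid.casesOn with
  | one => simp at hΔ
  | of_mul y Γ =>
    rw [FreeMonoid.length_mul, FreeMonoid.length_of] at hΔ
    rw [coeffs_var_mul_of_mem_degLE hS hg x y (by omega), hg Γ (by omega), map_zero, ite_self]

theorem word_mul_mem_degLE {n : ℕ} {g : S} (hg : g ∈ hS.degLE n) (Δ : FreeMonoid X) :
    FreeMonoid.lift v Δ * g ∈ hS.degLE (Δ.length + n) := by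
  induction Δ using FreeMonoid.inductionOn' with
  | one => simpa using hg
  | of_mul x Δ ih =>
    rw [map_mul, mul_assoc, FreeMonoid.lift_eval_of, FreeMonoid.length_mul, FreeMonoid.length_of,
      show 1 + Δ.length + n = Δ.length + n + 1 by ring]
    exact var_mul_mem_degLE hS ih x

theorem coeffs_word_mul [DecidableEq (FreeMonoid X)] {n : ℕ} {g : S} (hg : g ∈ hS.degLE n)
    (Δ Δ' Γ : FreeMonoid X) (hΔ : Δ'.length = Δ.length) (hΓ : Γ.length = n) :
    hS.coeffs (FreeMonoid.lift v Δ * g) (Δ' * Γ) =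
      if Δ' = Δ then wordAut σ Δ (hS.coeffs g Γ) else 0 := by
  classical
  induction Δ using FreeMonoid.inductionOn' generalizing Δ' with
  | one =>
    have : Δ' = 1 := FreeMonoid.length_eq_zero.1 hΔ
    simp [this]
  | of_mul x Δ ih =>
    induction Δ' using FreeMonoid.casesOn with
    | one =>
      rw [FreeMonoid.length_mul, FreeMonoid.length_of, FreeMonoid.length_one] at hΔ
      omega
    | of_mul y Δ' =>
      simp only [FreeMonoid.length_mul, FreeMonoid.length_of] at hΔ
      have hcons : FreeMonoid.of y * Δ' = FreeMonoid.of x * Δ ↔ y = x ∧ Δ' = Δ :=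
        List.cons_eq_cons
      rw [(FreeMonoid.lift v).map_mul, mul_assoc, FreeMonoid.lift_eval_of, mul_assoc,
        coeffs_var_mul_of_mem_degLE hS (word_mul_mem_degLE hS hg Δ) x y
          (by rw [FreeMonoid.length_mul]; omega), ih Δ' (by omega), wordAut_of_mul_apply]
      simp only [hcons]
      by_cases h1 : y = x <;> by_cases h2 : Δ' = Δ <;> simp [h1, h2]

theorem mul_mem_degLE {m n : ℕ} {f g : S} (hf : f ∈ hS.degLE m) (hg : g ∈ hS.degLE n) :
    f * g ∈ hS.degLE (m + n) := by
  rw [← hS.skewSum_coeffs f, skewSum, Finsupp.sum, Finset.sum_mul]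
  refine sum_mem fun Δ hΔ => ?_
  have hlen : Δ.length ≤ m := by
    by_contra h
    exact Finsupp.mem_support_iff.1 hΔ (hf Δ (not_le.1 h))
  intro Γ hΓ
  rw [mul_assoc, coeffs_coeff_mul, Finsupp.smul_apply,
    word_mul_mem_degLE hS hg Δ Γ (by omega), smul_zero]

/-- In the top degree coefficients multiply without interference, since a word of length `m + n`
factors in only one way into words of lengths `m` and `n`. -/
theorem coeffs_mul {m n : ℕ} {f g : S} (hf : f ∈ hS.degLE m) (hg : g ∈ hS.degLE n)
    {Δ Γ : FreeMonoid X} (hΔ : Δ.length = m) (hΓ : Γ.length = n) :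
    hS.coeffs (f * g) (Δ * Γ) = hS.coeffs f Δ * wordAut σ Δ (hS.coeffs g Γ) := by
  classical
  conv_lhs => rw [← hS.skewSum_coeffs f, skewSum, Finsupp.sum, Finset.sum_mul]
  rw [map_sum, Finsupp.finsetSum_apply]
  have hterm : ∀ E : FreeMonoid X, E ∈ (hS.coeffs f).support →
      hS.coeffs (ι (hS.coeffs f E) * FreeMonoid.lift v E * g) (Δ * Γ) =
        if Δ = E then hS.coeffs f E * wordAut σ E (hS.coeffs g Γ) else 0 := by
    intro E hE
    rw [mul_assoc, coeffs_coeff_mul, Finsupp.smul_apply, smul_eq_mul]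
    have hlen : E.length ≤ m := by
      by_contra h
      exact Finsupp.mem_support_iff.1 hE (hf E (not_le.1 h))
    rcases hlen.lt_or_eq with h | h
    · rw [word_mul_mem_degLE hS hg E _ (by rw [FreeMonoid.length_mul]; omega), mul_zero, if_neg]
      rintro rfl
      omega
    · rw [coeffs_word_mul hS hg E Δ Γ (by omega) hΓ]
      split_ifs <;> simp
  rw [Finset.sum_congr rfl hterm, Finset.sum_ite_eq, ite_eq_left_iff]
  intro h
  rw [Finsupp.notMem_support_iff.1 h, zero_mul]

theorem coeff_mem_degLE (r : R) : ι r ∈ hS.degLE 0 := by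
  simpa using hS.monomial_mem_degLE r 1

theorem coeffs_coeff_one (r : R) : hS.coeffs (ι r) 1 = r := by
  have := hS.coeffs_monomial r 1
  rw [map_one, mul_one] at this
  rw [this, Finsupp.single_eq_same]

theorem word_mem_degLE (Δ : FreeMonoid X) : FreeMonoid.lift v Δ ∈ hS.degLE Δ.length := by
  simpa using hS.monomial_mem_degLE 1 Δ

theorem coeffs_word (Δ : FreeMonoid X) : hS.coeffs (FreeMonoid.lift v Δ) Δ = 1 := by
  have := hS.coeffs_monomial 1 Δ
  rw [map_one, one_mul] at this
  rw [this, Finsupp.single_eq_same]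

/-- For a left ideal `J` of the extension, the left ideal of the coefficients at the word `Δ` of
the elements of `J` of degree at most the length of `Δ`. -/
noncomputable def leadIdeal (J : Ideal S) (Δ : FreeMonoid X) : Ideal R where
  carrier := {a | ∃ f ∈ J, f ∈ hS.degLE Δ.length ∧ hS.coeffs f Δ = a}
  zero_mem' := ⟨0, zero_mem _, zero_mem _, by simp⟩
  add_mem' := by
    rintro _ _ ⟨f, hf, hf', rfl⟩ ⟨g, hg, hg', rfl⟩
    exact ⟨f + g, add_mem hf hg, add_mem hf' hg', by simp⟩
  smul_mem' := by
    rintro r _ ⟨f, hf, hf', rfl⟩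
    refine ⟨ι r * f, J.mul_mem_left _ hf, ?_, by simp [coeffs_coeff_mul]⟩
    simpa using mul_mem_degLE hS (hS.coeff_mem_degLE r) hf'

variable {hS}

theorem leadIdeal_isTwoSided (J : Ideal S) [J.IsTwoSided] (Δ : FreeMonoid X) :
    (hS.leadIdeal J Δ).IsTwoSided where
  mul_mem_of_left := by
    rintro _ b ⟨f, hf, hf', rfl⟩
    refine ⟨f * ι ((wordAut σ Δ).symm b), J.mul_mem_right _ hf,
      mul_mem_degLE hS hf' (hS.coeff_mem_degLE _), ?_⟩
    have := coeffs_mul hS hf' (hS.coeff_mem_degLE ((wordAut σ Δ).symm b)) rfl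
      FreeMonoid.length_one
    rw [mul_one, coeffs_coeff_one] at this
    rw [this, RingEquiv.apply_symm_apply]

theorem leadIdeal_le_mul (J : Ideal S) [J.IsTwoSided] (Δ Γ : FreeMonoid X) :
    hS.leadIdeal J Δ ≤ hS.leadIdeal J (Δ * Γ) := by
  rintro _ ⟨f, hf, hf', rfl⟩
  refine ⟨f * FreeMonoid.lift v Γ, J.mul_mem_right _ hf, ?_, ?_⟩
  · rw [FreeMonoid.length_mul]
    exact mul_mem_degLE hS hf' (hS.word_mem_degLE Γ)
  · rw [coeffs_mul hS hf' (hS.word_mem_degLE Γ) rfl rfl, coeffs_word, map_one, mul_one]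

theorem wordAut_mem_leadIdeal {J : Ideal S} (Δ : FreeMonoid X) {Γ : FreeMonoid X} {b : R}
    (hb : b ∈ hS.leadIdeal J Γ) : wordAut σ Δ b ∈ hS.leadIdeal J (Δ * Γ) := by
  obtain ⟨f, hf, hf', rfl⟩ := hb
  refine ⟨FreeMonoid.lift v Δ * f, J.mul_mem_left _ hf, ?_, ?_⟩
  · rw [FreeMonoid.length_mul]
    exact mul_mem_degLE hS (hS.word_mem_degLE Δ) hf'
  · rw [coeffs_mul hS (hS.word_mem_degLE Δ) hf' rfl rfl, coeffs_word, one_mul]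

theorem exists_leading {J : Ideal S} {f : S} (hf : f ∈ J) (h0 : f ≠ 0) :
    ∃ Γ : FreeMonoid X, f ∈ hS.degLE Γ.length ∧ hS.coeffs f Γ ≠ 0 ∧
      hS.coeffs f Γ ∈ hS.leadIdeal J Γ := by
  have hne : (hS.coeffs f).support.Nonempty := by
    rw [Finsupp.support_nonempty_iff]
    simpa using h0
  obtain ⟨Γ, hΓ, hmax⟩ := Finset.exists_max_image _ FreeMonoid.length hne
  have hdeg : f ∈ hS.degLE Γ.length := by
    intro Δ hΔ
    by_contra h
    exact absurd (hmax Δ (Finsupp.mem_support_iff.2 h)) (not_le.2 hΔ)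
  exact ⟨Γ, hdeg, Finsupp.mem_support_iff.1 hΓ, f, hf, hdeg, rfl⟩

end IsFreeSkewExtension

/-- Mathlib's description of the Jacobson radical gives left inverses; this gives a right one. -/
theorem exists_one_sub_mul_eq_one {A : Type*} [Ring A] {f : A} (hf : f ∈ Ring.jacobson A) :
    ∃ z, (1 - f) * z = 1 := by
  have key : ∀ g ∈ Ring.jacobson A, ∃ z, z * (1 + g) = 1 := by
    intro g hg
    rw [← Ideal.jacobson_bot, Ideal.mem_jacobson_iff] at hg
    obtain ⟨z, hz⟩ := hg 1
    refine ⟨z, ?_⟩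
    rw [Ideal.mem_bot, sub_eq_zero, mul_one] at hz
    rw [mul_add, mul_one, add_comm, hz]
  obtain ⟨z, hz⟩ := key (-f) (neg_mem hf)
  -- The left inverse `z = 1 + z f` of `1 - f` is itself left invertible.
  obtain ⟨z', hz'⟩ := key (z * f) (Ideal.mul_mem_left _ z hf)
  have h1 : 1 + z * f = z := by
    rw [← hz]
    noncomm_ring
  rw [h1] at hz'
  refine ⟨z, ?_⟩
  have h2 : z' = 1 - f := by
    rw [sub_eq_add_neg]
    exact left_inv_eq_right_inv hz' hz
  rwa [← h2]

/-- A free skew extension of a semiprime left Goldie ring, in at least one variable, is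
semiprimitive. -/
theorem IsFreeSkewExtension.jacobson_eq_bot [Nonempty X]
    (hS : IsFreeSkewExtension (fun x => (σ x : R →+* R)) δ ι v) (hG : IsLeftGoldie R)
    (hR : IsSemiprimeElementwise R) : Ring.jacobson S = ⊥ := by
  set J := Ring.jacobson S with hJ
  let dbl : Ideal R → Ideal R := fun I => leftAnnihilator (leftAnnihilator (I : Set R) : Set R)
  have hdbl : ∀ {I I' : Ideal R}, I ≤ I' → dbl I ≤ dbl I' := fun h =>
    leftAnnihilator_anti (leftAnnihilator_anti h)
  have hle : ∀ I : Ideal R, I ≤ dbl I := fun I a ha y hy => hR.mul_eq_zero_comm hy ha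
  obtain ⟨Δ₀, hΔ₀⟩ := hG.exists_maximal
    (fun Δ : FreeMonoid X => (leftAnnihilator (hS.leadIdeal J Δ : Set R) : Set R))
  obtain ⟨x⟩ := ‹Nonempty X›
  -- A word of positive length whose ideal of leading coefficients has maximal double annihilator.
  obtain ⟨Δ, hΔpos, hΔ⟩ : ∃ Δ : FreeMonoid X, 0 < Δ.length ∧
      ∀ Γ, hS.leadIdeal J (Δ * Γ) ≤ dbl (hS.leadIdeal J Δ) := by
    refine ⟨Δ₀ * FreeMonoid.of x, by simp, fun Γ => ?_⟩
    have h1 := leadIdeal_le_mul (hS := hS) J Δ₀ (FreeMonoid.of x)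
    have h2 := leadIdeal_le_mul (hS := hS) J Δ₀ (FreeMonoid.of x * Γ)
    rw [← mul_assoc] at h2
    exact (hle _).trans ((hΔ₀ _ (hdbl h2)).trans (hdbl h1))
  obtain ⟨c, ⟨f, hfJ, hfdeg, hfc⟩, hc⟩ :=
    hG.exists_mem_regular_on hR (hS.leadIdeal J Δ) (leadIdeal_isTwoSided J Δ)
  -- Multiplication by `1 - f` raises the degree of every nonzero element of `J`.
  have hraise : ∀ u ∈ J, u ≠ 0 → ∃ k, u ∈ hS.degLE k ∧
      ∀ n, (1 - f) * u ∈ hS.degLE n → k + Δ.length ≤ n := by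
    intro u hu h0
    obtain ⟨Γ, hΓ, hne, hmem⟩ := exists_leading (hS := hS) hu h0
    refine ⟨Γ.length, hΓ, fun n hn => ?_⟩
    by_contra hlt
    have h1 := hn (Δ * Γ) (by rw [FreeMonoid.length_mul]; omega)
    rw [sub_mul, one_mul, map_sub, Finsupp.sub_apply, coeffs_mul hS hfdeg hΓ rfl rfl, hfc,
      hΓ (Δ * Γ) (by rw [FreeMonoid.length_mul]; omega), zero_sub, neg_eq_zero] at h1
    have h2 := hc _ (hΔ Γ (wordAut_mem_leadIdeal Δ hmem)) h1
    exact hne (by simpa using h2)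
  obtain ⟨z, hz⟩ := exists_one_sub_mul_eq_one hfJ
  classical
  by_contra hJ0
  obtain ⟨h, hhJ, hh0⟩ := Submodule.exists_mem_ne_zero_of_ne_bot hJ0
  have hex : ∃ n, ∃ h ∈ J, h ≠ 0 ∧ h ∈ hS.degLE n := by
    obtain ⟨n, hn⟩ := hS.exists_degLE h
    exact ⟨n, h, hhJ, hh0, hn⟩
  -- An element of `J` of minimal degree is `1 - f` times another one, of smaller degree.
  obtain ⟨h, hhJ, hh0, hn⟩ := Nat.find_spec hex
  have hzh : (1 - f) * (z * h) = h := by rw [← mul_assoc, hz, one_mul]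
  have hzJ : z * h ∈ J := J.mul_mem_left z hhJ
  have hz0 : z * h ≠ 0 := fun h0 => hh0 (by rw [← hzh, h0, mul_zero])
  obtain ⟨k, hk, hkn⟩ := hraise (z * h) hzJ hz0
  have hlt := hkn _ (by rwa [hzh])
  exact Nat.find_min hex (m := k) (by omega) ⟨z * h, hzJ, hz0, hk⟩

end Leading

/-! ### Reduction modulo the prime radical -/

section Reduction

/-- The elementwise form of primeness, `a R b ⊆ Q` implies `a ∈ Q` or `b ∈ Q`. -/
theorem IsPrimeTwoSided.mem_or_mem {R : Type*} [Ring R] {Q : Ideal R} (hQ : IsPrimeTwoSided Q)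
    {a b : R} (h : ∀ r, a * r * b ∈ Q) : a ∈ Q ∨ b ∈ Q := by
  have := hQ.isTwoSided
  let I : Ideal R :=
    { carrier := {x | ∀ r, x * r * b ∈ Q}
      zero_mem' := fun r => by simp
      add_mem' := fun hx hy r => by rw [add_mul, add_mul]; exact add_mem (hx r) (hy r)
      smul_mem' := fun c x hx r => by
        rw [smul_eq_mul, mul_assoc, mul_assoc, ← mul_assoc x]
        exact Q.mul_mem_left c (hx r) }
  let J : Ideal R :=
    { carrier := {y | ∀ x ∈ I, ∀ r, x * r * y ∈ Q}
      zero_mem' := fun x _ r => by simp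
      add_mem' := fun hy hz x hx r => by rw [mul_add]; exact add_mem (hy x hx r) (hz x hx r)
      smul_mem' := fun c y hy x hx r => by
        rw [smul_eq_mul, ← mul_assoc, mul_assoc x]
        exact hy x hx (r * c) }
  have hI : I.IsTwoSided := ⟨fun s hx r => by rw [mul_assoc _ s r]; exact hx (s * r)⟩
  have hJ : J.IsTwoSided := ⟨fun s hy x hx r => by
    rw [← mul_assoc]; exact Q.mul_mem_right s (hy x hx r)⟩
  have hIJ : I * J ≤ Q := Ideal.mul_le.2 fun x hx y hy => by simpa using hy x hx 1
  exact (hQ.le_or_le I J hI hJ hIJ).imp (fun hle => hle h) fun hle => hle fun x hx => hx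

variable {R : Type*} [Ring R]

theorem IsPrimeTwoSided.comap_equiv {Q : Ideal R} (hQ : IsPrimeTwoSided Q) (e : R ≃+* R) :
    IsPrimeTwoSided (Q.comap (e : R →+* R)) where
  isTwoSided := by
    have := hQ.isTwoSided
    infer_instance
  ne_top := fun h => hQ.ne_top <| by
    rw [Ideal.eq_top_iff_one] at h ⊢
    simpa using h
  le_or_le I J hI hJ hIJ := by
    by_contra! hcon
    obtain ⟨a, haI, ha⟩ := SetLike.not_le_iff_exists.1 hcon.1
    obtain ⟨b, hbJ, hb⟩ := SetLike.not_le_iff_exists.1 hcon.2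
    refine (hQ.mem_or_mem fun r => ?_).elim ha hb
    have : a * e.symm r * b ∈ Q.comap (e : R →+* R) :=
      hIJ (Ideal.mul_mem_mul (hI.mul_mem_of_left _ haI) hbJ)
    simpa using this

theorem primeRadical_le_comap (e : R ≃+* R) :
    primeRadical R ≤ (primeRadical R).comap (e : R →+* R) := fun _ ha =>
  Submodule.mem_sInf.2 fun _ hQ => Submodule.mem_sInf.1 ha _ (IsPrimeTwoSided.comap_equiv hQ e)

theorem primeRadical_eq_map (e : R ≃+* R) :
    primeRadical R = (primeRadical R).map (e : R →+* R) := by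
  refine le_antisymm (fun a ha => ?_) (Ideal.map_le_iff_le_comap.2 (primeRadical_le_comap e))
  have h : e.symm a ∈ primeRadical R := primeRadical_le_comap e.symm ha
  simpa using Ideal.mem_map_of_mem (e : R →+* R) h

theorem isSemiprimeElementwise_quotient_primeRadical :
    IsSemiprimeElementwise (R ⧸ primeRadical R) := by
  intro a ha
  obtain ⟨a, rfl⟩ := Ideal.Quotient.mk_surjective a
  rw [Ideal.Quotient.eq_zero_iff_mem]
  refine Submodule.mem_sInf.2 fun Q hQ => ?_
  refine (or_self_iff.1 (IsPrimeTwoSided.mem_or_mem hQ fun r => ?_))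
  have := ha (Ideal.Quotient.mk _ r)
  rw [← map_mul, ← map_mul, Ideal.Quotient.eq_zero_iff_mem] at this
  exact Submodule.mem_sInf.1 this Q hQ

/-- The automorphism of `R` modulo its prime radical induced by an automorphism of `R`. -/
noncomputable def quotientAut (e : R ≃+* R) : R ⧸ primeRadical R ≃+* R ⧸ primeRadical R :=
  Ideal.quotientEquiv _ _ e (primeRadical_eq_map e)

/-- The additive map on a quotient ring induced by an additive map preserving the ideal. -/
noncomputable def quotientDer {I : Ideal R} (d : R →+ R) (hd : ∀ a ∈ I, d a ∈ I) :
    R ⧸ I →+ R ⧸ I :=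
  QuotientAddGroup.map I.toAddSubgroup I.toAddSubgroup d hd

theorem quotientDer_mk {I : Ideal R} [I.IsTwoSided] (d : R →+ R) (hd : ∀ a ∈ I, d a ∈ I) (r : R) :
    quotientDer d hd (Ideal.Quotient.mk I r) = Ideal.Quotient.mk I (d r) := rfl

theorem isSkewDerivation_quotientDer {e : R ≃+* R} {d : R →+ R}
    (h : IsSkewDerivation (e : R →+* R) d) (hd : ∀ a ∈ primeRadical R, d a ∈ primeRadical R) :
    IsSkewDerivation (quotientAut e : R ⧸ primeRadical R →+* R ⧸ primeRadical R)
      (quotientDer d hd) := by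
  intro a b
  obtain ⟨a, rfl⟩ := Ideal.Quotient.mk_surjective a
  obtain ⟨b, rfl⟩ := Ideal.Quotient.mk_surjective b
  rw [← map_mul, quotientDer_mk, h a b, map_add, map_mul, map_mul]
  rfl

end Reduction

/-! ### Nilpotence of the kernel of the reduction -/

section Nilpotence

variable {R S X : Type*} [Ring R] [Ring S] {σ : X → R →+* R} {δ : X → R →+ R} {ι : R →+* S}
  {v : X → S}

/-- A nilpotent two-sided ideal is contained in the Jacobson radical. -/
theorem Ideal.le_ringJacobson_of_isNilpotent {K : Ideal S} [K.IsTwoSided] (hK : IsNilpotent K) :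
    K ≤ Ring.jacobson S := by
  intro x hx
  rw [← Ideal.jacobson_bot, Ideal.mem_jacobson_iff]
  intro y
  obtain ⟨n, hn⟩ := hK
  have hnil : IsNilpotent (y * x) :=
    ⟨n, by
      have := Submodule.pow_mem_pow K (K.mul_mem_left y hx) n
      rwa [hn] at this⟩
  obtain ⟨z, hz⟩ := hnil.isUnit_add_one.exists_left_inv
  refine ⟨z, ?_⟩
  rw [Ideal.mem_bot, ← hz]
  noncomm_ring

/-- If the elements of `K` have coefficients in `I`, then those of `K ^ n` have coefficients in
`I ^ n`. -/
theorem IsFreeSkewExtension.coeffs_mem_pow (hS : IsFreeSkewExtension σ δ ι v) {I : Ideal R}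
    [I.IsTwoSided] {K : Ideal S} (hK : ∀ s ∈ K, ∀ Δ, hS.coeffs s Δ ∈ I) (n : ℕ) :
    ∀ s ∈ K ^ n, ∀ Δ, hS.coeffs s Δ ∈ I ^ n := by
  induction n with
  | zero =>
    intro s _ Δ
    rw [Submodule.pow_zero, Ideal.one_eq_top]
    trivial
  | succ n ih =>
    intro s hs
    rw [Submodule.pow_succ] at hs ⊢
    induction hs using Submodule.mul_induction_on' with
    | add x _ y _ hx hy =>
      intro Δ
      rw [map_add, Finsupp.add_apply]
      exact add_mem (hx Δ) (hy Δ)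
    | mem_mul_mem s hs t ht =>
      intro Γ
      rw [← hS.skewSum_coeffs s, skewSum, Finsupp.sum, Finset.sum_mul, map_sum,
        Finsupp.finsetSum_apply]
      refine sum_mem fun Δ _ => ?_
      rw [mul_assoc, coeffs_coeff_mul, Finsupp.smul_apply, smul_eq_mul]
      exact Ideal.mul_mem_mul (ih s hs Δ) (hK _ (K.mul_mem_left _ ht) Γ)

end Nilpotence

/-! ### The Jacobson radical of a free skew extension -/

theorem mainTheorem3 {R S X : Type*} [Ring R] [Ring S] [Nonempty X]
    (σ : X → R ≃+* R) (δ : X → R →+ R)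
    (hδ : ∀ x, IsSkewDerivation (σ x : R →+* R) (δ x))
    (ι : R →+* S) (v : X → S)
    (hS : IsFreeSkewExtension (fun x => (σ x : R →+* R)) δ ι v)
    (hnil : IsNilpotent (primeRadical R))
    (hGoldie : IsLeftGoldie (R ⧸ primeRadical R))
    (hstable : ∀ x : X, ∀ a ∈ primeRadical R, δ x a ∈ primeRadical R) :
    IsNilpotent (Ring.jacobson S) ∧
      (Ring.jacobson S : Set S) = coeffsIn ι v (primeRadical R) := by
  -- The free skew extension `T` of `R / P`, and the reduction `φ : S → T`.
  let σ' := fun x => quotientAut (σ x)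
  let δ' := fun x => quotientDer (δ x) (hstable x)
  have hT := FreeSkew.isFreeSkewExtension
    (fun x => (σ' x : R ⧸ primeRadical R →+* R ⧸ primeRadical R)) δ'
    fun x => isSkewDerivation_quotientDer (hδ x) (hstable x)
  set T := FreeSkew.operatorRing
    (fun x => (σ' x : R ⧸ primeRadical R →+* R ⧸ primeRadical R)) δ'
  set ι' := FreeSkew.coeff (fun x => (σ' x : R ⧸ primeRadical R →+* R ⧸ primeRadical R)) δ'
  set v' := FreeSkew.var (fun x => (σ' x : R ⧸ primeRadical R →+* R ⧸ primeRadical R)) δ'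
  let φ : S →+* T := hS.lift (ι'.comp (Ideal.Quotient.mk _)) v' fun x r =>
    hT.relation x (Ideal.Quotient.mk _ r)
  have hφ : ∀ s, φ s = skewSum ι' v'
      ((hS.coeffs s).mapRange (Ideal.Quotient.mk (primeRadical R)) (map_zero _)) := by
    intro s
    change skewSum (ι'.comp (Ideal.Quotient.mk _)) v' (hS.coeffs s) = _
    rw [skewSum, skewSum, Finsupp.sum_mapRange_index (by simp)]
    rfl
  have hsurj : Function.Surjective φ := by
    intro t
    obtain ⟨g, rfl⟩ := hT.basis.2 t
    obtain ⟨f, rfl⟩ := Finsupp.mapRange_surjective _ (map_zero (Ideal.Quotient.mk (primeRadical R)))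
      Ideal.Quotient.mk_surjective g
    exact ⟨skewSum ι v f, by rw [hφ, hS.coeffs_skewSum]⟩
  have hker : ∀ s, s ∈ RingHom.ker φ ↔ ∀ Δ, hS.coeffs s Δ ∈ primeRadical R := by
    intro s
    have h0 : skewSum ι' v' 0 = 0 := by simp [skewSum]
    rw [RingHom.mem_ker, hφ, ← h0, hT.basis.1.eq_iff, Finsupp.ext_iff]
    simp [Ideal.Quotient.eq_zero_iff_mem]
  have hnilker : IsNilpotent (RingHom.ker φ) := by
    obtain ⟨n, hn⟩ := hnil
    refine ⟨n, (Submodule.eq_bot_iff _).2 fun s hs => ?_⟩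
    have h1 := hS.coeffs_mem_pow (fun s hs => (hker s).1 hs) n s hs
    rw [hn] at h1
    exact (map_eq_zero_iff hS.coeffs hS.coeffs.injective).1 (Finsupp.ext h1)
  have hJ : Ring.jacobson S = RingHom.ker φ := by
    refine le_antisymm ?_ (Ideal.le_ringJacobson_of_isNilpotent hnilker)
    have : RingHomSurjective φ := ⟨hsurj⟩
    have h1 := Ring.le_comap_jacobson φ
    rwa [hT.jacobson_eq_bot hGoldie isSemiprimeElementwise_quotient_primeRadical] at h1
  refine ⟨hJ ▸ hnilker, Set.ext fun s => ?_⟩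
  rw [hS.mem_coeffsIn, ← hker, hJ]
  rfl
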